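/- Let $\mu$ be a singular cardinal, $\lambda=\mu^+$, $\kappa=\operatorname{cf}(\mu)$, and let $\sigma$ be a regular cardinal with $\kappa<\sigma<\mu$. Let $S$ be a stationary subset of $S^\lambda_\sigma=\{\alpha<\lambda:\operatorname{cf}(\alpha)=\sigma\}$, and let $\langle\mu_i:i<\kappa\rangle$ be a strictly increasing continuous sequence of cardinals below $\mu$ that is cofinal in $\mu$. Let $\langle c_\delta:\delta\in S\rangle$ be such that each $c_\delta$ is a strictly increasing continuous function from $\sigma$ onto a cofinal subset of $\delta$, and such that for every closed unbounded $E\subseteq\lambda$ the set $\{\delta\in S:\operatorname{ran}(c_\delta)\subseteq E\}$ is stationary in $\lambda$. For $a<\sigma$ put $I^\delta_a=(c_\delta(a),c_\delta(a+1)]$. For a closed unbounded $C\subseteq\delta$, let $\operatorname{acc}(C)$ be the set of nonzero $\alpha<\delta$ with $\alpha=\sup(C\cap\alpha)$, and $\operatorname{nacc}(C)=C\setminus\operatorname{acc}(C)$. For $\epsilon<\sigma$ and $i<\kappa$, write $a(\epsilon,i)=\kappa\cdot\epsilon+i$ (ordinal arithmetic: $\epsilon$ blocks of length $\kappa$, followed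 by $i$). Then there is a sequence $\langle C_\delta:\delta\in S\rangle$, with each $C_\delta$ closed and unbounded in $\delta$, such that: 1. $\operatorname{ran}(c_\delta)\subseteq C_\delta$ for every $\delta\in S$; 2. $|C_\delta\cap I^\delta_{a(\epsilon,i)}|\le\mu_i^+$ for all $\delta\in S$, $\epsilon<\sigma$, $i<\kappa$; 3. for all $\delta\in S$, $\epsilon<\sigma$, $i<\kappa$, every $\alpha\in\operatorname{nacc}(C_\delta)\cap I^\delta_{a(\epsilon,i)}$ satisfies $\operatorname{cf}(\alpha)>\mu_i^+$, except possibly $\alpha=c_\delta(a(\epsilon,i)+1)$ (the right endpoint of the interval) when this ordinal is not a limit of ordinals of cofinality $>\mu_i^+$; 4. for every closed unbounded $E\subseteq\lambda$ there are stationarily many $\delta\in S$ such that, for all $\epsilon<\sigma$ and $i<\kappa$, every $\alpha\in\operatorname{nacc}(C_\delta)\cap I^\delta_{a(\epsilon,i)}$ satisfies $\operatorname{cf}(\alpha)>\mu_i^+$ (there is no exception at $\delta$ in (3)), and $E\cap\operatorname{nacc}(C_\delta)\cap I^\delta_{a(\epsilon,i)}\neq\emptyset$. -/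

import Mathlib

open Cardinal Ordinal Order Set

universe u

namespace OffCenter

/-- `C` is a closed unbounded subset of the ordinal `δ` (identified with the set of ordinals
below `δ`). -/
def IsClubIn (δ : Ordinal.{u}) (C : Set Ordinal.{u}) : Prop :=
  C ⊆ Iio δ ∧ IsClub ((fun x : Iio δ => (x : Ordinal.{u})) ⁻¹' C)

/-- `S` is a stationary subset of the ordinal `δ`. -/
def IsStationaryIn (δ : Ordinal.{u}) (S : Set Ordinal.{u}) : Prop :=
  S ⊆ Iio δ ∧ IsStationary ((fun x : Iio δ => (x : Ordinal.{u})) ⁻¹' S)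

/-- The set of ordinals below the cardinal `l` that have cofinality `s`. -/
def cofSet (l s : Cardinal.{u}) : Set Ordinal.{u} :=
  {α | α < l.ord ∧ α.cof = s}

/-- The accumulation points of `C` below `δ`: the nonzero `α < δ` with `α = sup (C ∩ α)`. -/
def acc (δ : Ordinal.{u}) (C : Set Ordinal.{u}) : Set Ordinal.{u} :=
  {α | α < δ ∧ α ≠ 0 ∧ IsLUB (C ∩ Iio α) α}

/-- The non-accumulation points of a subset `C` of `δ`. -/
def nacc (δ : Ordinal.{u}) (C : Set Ordinal.{u}) : Set Ordinal.{u} :=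
  C \ acc δ C

/-- `m` restricted to the ordinals below `k` is a strictly increasing continuous sequence
of cardinals that are smaller than `μ` and cofinal in `μ`. -/
structure IsCardinalLadder (μ k : Cardinal.{u}) (m : Ordinal.{u} → Cardinal.{u}) : Prop where
  strictMonoOn : StrictMonoOn m (Iio k.ord)
  continuous : ∀ i < k.ord, IsSuccLimit i → IsLUB (m '' Iio i) (m i)
  lt : ∀ i < k.ord, m i < μ
  cofinal : ∀ ν < μ, ∃ i < k.ord, ν ≤ m i

/-- `f` restricted to the ordinals below `s` is a strictly increasing continuous function onto a
cofinal subset of `δ`. -/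
structure IsLadder (s : Cardinal.{u}) (δ : Ordinal.{u}) (f : Ordinal.{u} → Ordinal.{u}) :
    Prop where
  strictMonoOn : StrictMonoOn f (Iio s.ord)
  continuous : ∀ ξ < s.ord, IsSuccLimit ξ → IsLUB (f '' Iio ξ) (f ξ)
  lt : ∀ ξ < s.ord, f ξ < δ
  cofinal : ∀ β < δ, ∃ ξ < s.ord, β ≤ f ξ

/-- The range of a function whose domain is the cardinal `s`. -/
def ran (s : Cardinal.{u}) (f : Ordinal.{u} → Ordinal.{u}) : Set Ordinal.{u} :=
  f '' Iio s.ord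

/-- `c` assigns a ladder to every `δ ∈ S`, and for every club `E` of `l` there are stationarily
many `δ ∈ S` whose ladder is contained in `E`. -/
structure IsGuessing (l s : Cardinal.{u}) (S : Set Ordinal.{u})
    (c : Ordinal.{u} → Ordinal.{u} → Ordinal.{u}) : Prop where
  ladder : ∀ δ ∈ S, IsLadder s δ (c δ)
  guess : ∀ E, IsClubIn l.ord E → IsStationaryIn l.ord {δ | δ ∈ S ∧ ran s (c δ) ⊆ E}

/-- The half-open interval `(f a, f (a + 1)]`. -/
def interval (f : Ordinal.{u} → Ordinal.{u}) (a : Ordinal.{u}) : Set Ordinal.{u} :=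
  Ioc (f a) (f (a + 1))

/-- The index of the `i`-th piece of the `ε`-th block, where blocks have length `k`. In Mathlib,
as in the usual convention, the ordinal product `k * ε` is `k` repeated `ε` times. -/
noncomputable def index (k : Cardinal.{u}) (ε i : Ordinal.{u}) : Ordinal.{u} :=
  k.ord * ε + i

/-- `C` assigns a closed unbounded subset of `δ` to every `δ ∈ S`. -/
def IsClubSystem (S : Set Ordinal.{u}) (C : Ordinal.{u} → Set Ordinal.{u}) : Prop :=
  ∀ δ ∈ S, IsClubIn δ (C δ)

/-- `α` is a limit of ordinals of cofinality greater than `ν`. -/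
def IsLimitOfCofGT (ν : Cardinal.{u}) (α : Ordinal.{u}) : Prop :=
  α ≠ 0 ∧ IsLUB {β | β < α ∧ ν < β.cof} α

end OffCenter

namespace OffCenter

/-! Write λ = μ⁺. Given a club E of λ, fill the interval (c a, c (a+1)], where ν = μ_i⁺, by walking
down from c (a+1) along a fixed system `e` of clubs of minimal size. Each point of a club of `e` is
first dropped to the largest element at or below it of the closure of `large E ν`, and walks stop at
points of cofinality above ν. The drops keep the clubs closed and of size at most ν, so the set of
reached points is closed and has at most ν elements. A reached point of cofinality at most ν, other
than the start, is in the closure of `large E ν` but not in the set itself. It is therefore a limit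
of that set, the dropped club accumulates to it, and it is an accumulation point. A reached point of
cofinality above ν cannot be a limit of only ν points. If c (a+1) is not a limit of `large E ν`, all
ordinals replace E; this leaves only the exception allowed in clause 3.

Some E makes this system guess. Otherwise each E has a club F(E) witnessing failure. Iterate F with
intersections to get decreasing clubs E_ζ for ζ ≤ σ⁺, and use the guessing of c to find δ in E_{σ⁺}
whose ladder consists of limits of points of E_{σ⁺} of large cofinality. In each interval fix such a
point β of E_{σ⁺} and walk towards it. As ζ grows the drops only decrease, so each step stabilises,
and well-foundedness makes the whole walk stabilise at some t of cofinality above ν that lies in all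
later E_ζ (`exists_eventually_reach`). There are only σ intervals, so one ζ < σ⁺ works for all of
them. At that stage t is a non-accumulation point in E_{ζ+1} ⊆ F(E_ζ) in every interval,
contradicting the choice of F(E_ζ). -/

/-! ### Limit points and closures of sets of ordinals -/

/-- The nonzero ordinals below which `D` is unbounded. -/
def limitPts (D : Set Ordinal.{u}) : Set Ordinal.{u} :=
  {α | α ≠ 0 ∧ ∀ β < α, ∃ γ ∈ D, β < γ ∧ γ < α}

theorem limitPts_mono {D D' : Set Ordinal.{u}} (h : D ⊆ D') : limitPts D ⊆ limitPts D' := by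
  rintro α ⟨h0, hα⟩
  refine ⟨h0, fun β hβ => ?_⟩
  obtain ⟨γ, hγ, h1⟩ := hα β hβ
  exact ⟨γ, h hγ, h1⟩

theorem mem_limitPts_iff_isLUB {D : Set Ordinal.{u}} {α : Ordinal.{u}} :
    α ∈ limitPts D ↔ α ≠ 0 ∧ IsLUB (D ∩ Iio α) α := by
  refine and_congr_right fun _ => ⟨fun h => ⟨fun γ hγ => hγ.2.le, fun b hb => ?_⟩, fun h β hβ => ?_⟩
  · by_contra! hlt
    obtain ⟨γ, hγ, h1, h2⟩ := h b hlt
    exact (hb ⟨hγ, h2⟩).not_gt h1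
  · obtain ⟨γ, hγ, h1⟩ := (lt_isLUB_iff h).1 hβ
    exact ⟨γ, hγ.1, h1, hγ.2⟩

theorem isSuccLimit_of_mem_limitPts {D : Set Ordinal.{u}} {α : Ordinal.{u}}
    (h : α ∈ limitPts D) : IsSuccLimit α := by
  refine ⟨by simpa using h.1, fun β hβ => ?_⟩
  obtain ⟨γ, -, h1, h2⟩ := h.2 β hβ.lt
  exact hβ.2 h1 h2

/-- A set of ordinals with its limit points added. -/
def clos (D : Set Ordinal.{u}) : Set Ordinal.{u} := D ∪ limitPts D

theorem clos_mono {D D' : Set Ordinal.{u}} (h : D ⊆ D') : clos D ⊆ clos D' :=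
  union_subset_union h (limitPts_mono h)

theorem limitPts_clos (D : Set Ordinal.{u}) : limitPts (clos D) = limitPts D := by
  refine Subset.antisymm ?_ (limitPts_mono subset_union_left)
  rintro α ⟨h0, hα⟩
  refine ⟨h0, fun β hβ => ?_⟩
  obtain ⟨γ, hγ | hγ, h1, h2⟩ := hα β hβ
  · exact ⟨γ, hγ, h1, h2⟩
  · obtain ⟨η, hη, h3, h4⟩ := hγ.2 β h1
    exact ⟨η, hη, h3, h4.trans h2⟩

theorem isGreatest_csSup_clos {D : Set Ordinal.{u}} {γ : Ordinal.{u}}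
    (h : (clos D ∩ Iic γ).Nonempty) : IsGreatest (clos D ∩ Iic γ) (sSup (clos D ∩ Iic γ)) := by
  have hb : BddAbove (clos D ∩ Iic γ) := ⟨γ, fun x hx => hx.2⟩
  refine ⟨?_, fun x hx => le_csSup hb hx⟩
  by_contra hn
  have hle : sSup (clos D ∩ Iic γ) ≤ γ := csSup_le h fun x hx => hx.2
  have hlt : ∀ x ∈ clos D ∩ Iic γ, x < sSup (clos D ∩ Iic γ) := fun x hx =>
    (le_csSup hb hx).lt_of_ne fun he => hn (he ▸ hx)
  refine hn ⟨Or.inr ?_, hle⟩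
  rw [← limitPts_clos]
  obtain ⟨x, hx⟩ := h
  refine ⟨(zero_le.trans_lt (hlt x hx)).ne', fun β hβ => ?_⟩
  obtain ⟨z, hz, h1⟩ := exists_lt_of_lt_csSup ⟨x, hx⟩ hβ
  exact ⟨z, hz.1, h1, hlt z hz⟩

/-- Used contrapositively: a set of size at most ν has no limit point of cofinality above ν. -/
theorem lift_cof_le_of_mem_limitPts {A : Set Ordinal.{u}} {α : Ordinal.{u}}
    (h : α ∈ limitPts A) : Cardinal.lift.{u + 1} α.cof ≤ #(A ∩ Iio α : Set Ordinal.{u}) := by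
  rw [lift_cof, ← cof_Iio]
  have hc : IsCofinal ((fun x : Iio α => (x : Ordinal.{u})) ⁻¹' A) := by
    rintro ⟨β, hβ⟩
    obtain ⟨γ, hγ, h1, h2⟩ := h.2 β hβ
    exact ⟨⟨γ, h2⟩, hγ, h1.le⟩
  refine (Order.cof_le hc).trans ?_
  refine Cardinal.mk_le_of_injective (f := fun x => ⟨x.1.1, x.2, x.1.2⟩) ?_
  rintro ⟨⟨x, hx⟩, hx'⟩ ⟨⟨y, hy⟩, hy'⟩ hxy
  exact Subtype.ext (Subtype.ext (congrArg (fun z => z.1) hxy))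

theorem isClubIn_iff {δ : Ordinal.{u}} {C : Set Ordinal.{u}} :
    IsClubIn δ C ↔ C ⊆ Iio δ ∧ (∀ β < δ, ∃ γ ∈ C, β ≤ γ) ∧ ∀ β < δ, β ∈ limitPts C → β ∈ C := by
  refine and_congr_right fun hC => ⟨fun h => ⟨fun β hβ => ?_, fun β hβ hl => ?_⟩, fun h => ⟨?_, ?_⟩⟩
  · obtain ⟨γ, hγ, h1⟩ := h.isCofinal ⟨β, hβ⟩
    exact ⟨γ, hγ, h1⟩
  · have hlub := (mem_limitPts_iff_isLUB.1 hl).2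
    refine h.isLUB_mem (t := {x : Iio δ | x.1 ∈ C ∧ x.1 < β}) (x := ⟨β, hβ⟩) (fun x hx => hx.1) ?_ ?_
    · obtain ⟨γ, hγ, -, h2⟩ := hl.2 0 (pos_iff_ne_zero.2 hl.1)
      exact ⟨⟨γ, hC hγ⟩, hγ, h2⟩
    · refine ⟨fun x hx => hx.2.le, fun b hb => hlub.2 fun γ hγ => ?_⟩
      exact hb (a := ⟨γ, hC hγ.1⟩) hγ
  · rintro t ht ⟨z, hz⟩ - x hx
    by_contra hn
    refine hn (h.2 x x.2 ?_)
    have hlt : ∀ y ∈ t, y < x := fun y hy => (hx.1 hy).lt_of_ne fun he => hn (he ▸ ht hy)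
    refine ⟨(zero_le.trans_lt (show z.1 < x.1 from hlt z hz)).ne', fun β hβ => ?_⟩
    obtain ⟨y, hy, h1⟩ := (lt_isLUB_iff hx).1 (show (⟨β, hβ.trans x.2⟩ : Iio δ) < x from hβ)
    exact ⟨y, ht hy, h1, hlt y hy⟩
  · rintro ⟨β, hβ⟩
    obtain ⟨γ, hγ, h1⟩ := h.1 β hβ
    exact ⟨⟨γ, hC hγ⟩, hγ, h1⟩

theorem IsClubIn.image_val {δ : Ordinal.{u}} {C : Set (Iio δ)} (h : IsClub C) :
    IsClubIn δ ((fun x : Iio δ => (x : Ordinal.{u})) '' C) := by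
  refine ⟨?_, ?_⟩
  · rintro _ ⟨x, -, rfl⟩
    exact x.2
  · rwa [preimage_image_eq _ Subtype.val_injective]

/-- Every limit ordinal has a closed unbounded subset of size its cofinality. -/
theorem exists_closed_cofinal_card_le (y : Ordinal.{u}) (hy : IsSuccLimit y) :
    ∃ e : Set Ordinal.{u}, e ⊆ Iio y ∧ (∀ β < y, ∃ γ ∈ e, β ≤ γ) ∧
      (∀ β < y, β ∈ limitPts e → β ∈ e) ∧ #e ≤ Cardinal.lift.{u + 1} y.cof := by
  obtain ⟨s, hs, hsc⟩ := Order.exists_cof_eq (Iio y)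
  set A : Set Ordinal.{u} := (fun x : Iio y => (x : Ordinal.{u})) '' s
  have hAy : A ⊆ Iio y := by
    rintro _ ⟨x, -, rfl⟩
    exact x.2
  have hAcof : ∀ β < y, ∃ γ ∈ A, β ≤ γ := fun β hβ => by
    obtain ⟨γ, hγ, h1⟩ := hs ⟨β, hβ⟩
    exact ⟨γ, ⟨γ, hγ, rfl⟩, h1⟩
  have hAcard : #A ≤ Cardinal.lift.{u + 1} y.cof := by
    rw [lift_cof, ← cof_Iio, ← hsc]
    exact Cardinal.mk_image_le
  refine ⟨clos A ∩ Iio y, inter_subset_right, fun β hβ => ?_, fun β hβ hl => ?_, ?_⟩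
  · obtain ⟨γ, hγ, h1⟩ := hAcof β hβ
    exact ⟨γ, ⟨Or.inl hγ, hAy hγ⟩, h1⟩
  · refine ⟨Or.inr ?_, hβ⟩
    rw [← limitPts_clos]
    exact limitPts_mono inter_subset_left hl
  -- Closing off adds at most `#A` points: send a limit point to the least element of `A` at or
  -- above it. Between two limit points there is an element of `A`, so this map is injective.
  · have hinj : #(limitPts A ∩ Iio y : Set Ordinal.{u}) ≤ #A := by
      choose! g hg using fun β (hβ : β < y) =>
        (show ∃ γ, IsLeast (A ∩ Ici β) γ from by
          obtain ⟨γ, hγ, h1⟩ := hAcof β hβ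
          exact ⟨_, isLeast_csInf ⟨γ, hγ, h1⟩⟩)
      have key : ∀ β ∈ limitPts A ∩ Iio y, ∀ β' ∈ limitPts A ∩ Iio y, β < β' → g β ≠ g β' := by
        intro β hβ β' hβ' hlt he
        obtain ⟨γ, hγ, h1, h2⟩ := hβ'.1.2 β hlt
        have h3 := (hg β hβ.2).2 ⟨hγ, h1.le⟩
        have h4 : β' ≤ g β' := (hg β' hβ'.2).1.2
        exact (h4.trans (he ▸ h3)).not_gt h2
      refine Cardinal.mk_le_of_injective (f := fun x => ⟨g x.1, (hg x.1 x.2.2).1.1⟩) ?_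
      rintro ⟨x, hx⟩ ⟨z, hz⟩ hxz
      have he : g x = g z := congrArg Subtype.val hxz
      rcases lt_trichotomy x z with h | h | h
      · exact absurd he (key x hx z hz h)
      · exact Subtype.ext h
      · exact absurd he.symm (key z hz x hx h)
    have hinf : ℵ₀ ≤ Cardinal.lift.{u + 1} y.cof := by
      rwa [Cardinal.aleph0_le_lift, Ordinal.aleph0_le_cof_iff, one_lt_cof_iff]
    have hsub : clos A ∩ Iio y ⊆ A ∪ (limitPts A ∩ Iio y) := by
      rintro x ⟨hx | hx, h⟩
      · exact Or.inl hx
      · exact Or.inr ⟨hx, h⟩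
    calc #(clos A ∩ Iio y : Set Ordinal.{u}) ≤ _ := Cardinal.mk_le_mk_of_subset hsub
      _ ≤ #A + #(limitPts A ∩ Iio y : Set Ordinal.{u}) := Cardinal.mk_union_le _ _
      _ ≤ Cardinal.lift.{u + 1} y.cof + Cardinal.lift.{u + 1} y.cof :=
        add_le_add hAcard (hinj.trans hAcard)
      _ = _ := Cardinal.add_eq_self hinf

/-! ### Walks along a system of sets -/

/-- `Reach f y β` says that the walk from `y` towards `β`, which moves from a point `x` to the least
element of `f x` that is at least `β`, arrives at `β`. -/
inductive Reach (f : Ordinal.{u} → Set Ordinal.{u}) : Ordinal.{u} → Ordinal.{u} → Prop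
  | refl (y : Ordinal.{u}) : Reach f y y
  | step {y v β : Ordinal.{u}} (h : IsLeast (f y ∩ Ici β) v) (hv : Reach f v β) : Reach f y β

section Reach

variable {f : Ordinal.{u} → Set Ordinal.{u}}

theorem Reach.of_mem {y v : Ordinal.{u}} (h : v ∈ f y) : Reach f y v :=
  .step ⟨⟨h, mem_Ici.2 le_rfl⟩, fun _ hw => hw.2⟩ (.refl v)

theorem Reach.le (hf : ∀ y, f y ⊆ Iio y) {y β : Ordinal.{u}} (h : Reach f y β) : β ≤ y := by
  induction h with
  | refl => exact le_rfl
  | step h hv ih => exact ih.trans (hf _ h.1.1).le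

theorem Reach.eq_or_mem {y β : Ordinal.{u}} (h : Reach f y β) : β = y ∨ ∃ v, β ∈ f v := by
  induction h with
  | refl => exact Or.inl rfl
  | step h hv ih =>
    rcases ih with rfl | ih
    · exact Or.inr ⟨_, h.1.1⟩
    · exact Or.inr ih

/-- Walks descend, so well-founded induction on the start applies: a union of at most c sets of size
at most c has size at most c. -/
theorem mk_reach_le (hf : ∀ y, f y ⊆ Iio y) {c : Cardinal.{u + 1}} (hc : ℵ₀ ≤ c)
    (hfc : ∀ y, #(f y) ≤ c) (y : Ordinal.{u}) : #{β | Reach f y β} ≤ c := by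
  induction y using WellFoundedLT.induction with
  | ind y ih =>
    have hsub : {β | Reach f y β} ⊆ {y} ∪ ⋃ v : f y, {β | Reach f v β} := by
      intro β hβ
      cases hβ with
      | refl => exact Or.inl rfl
      | step h hv => exact Or.inr (mem_iUnion.2 ⟨⟨_, h.1.1⟩, hv⟩)
    have hU : #(⋃ v : f y, {β | Reach f v β}) ≤ c := by
      refine (Cardinal.mk_iUnion_le _).trans ?_
      refine (mul_le_mul' (hfc y) (ciSup_le' fun v : f y => ih v.1 (hf y v.2))).trans ?_
      exact (Cardinal.mul_eq_self hc).le
    calc #{β | Reach f y β} ≤ _ := Cardinal.mk_le_mk_of_subset hsub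
      _ ≤ _ := Cardinal.mk_union_le _ _
      _ ≤ c + c := add_le_add (by simpa using (Cardinal.one_le_aleph0).trans hc) hU
      _ = c := Cardinal.add_eq_self hc

/-- If β is not in the closed set `f y`, then `f y` misses an interval (β₀, β]. Walks towards points
of (β₀, β) then share their first step with the walk towards β, and induction applies at the next
point. -/
theorem Reach.of_mem_limitPts (hf : ∀ y, f y ⊆ Iio y)
    (hcl : ∀ y, ∀ β < y, β ∈ limitPts (f y) → β ∈ f y) (y : Ordinal.{u}) :
    ∀ β ≤ y, β ∈ limitPts {ξ | Reach f y ξ} → Reach f y β := by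
  induction y using WellFoundedLT.induction with
  | ind y ih =>
    intro β hβy hβ
    rcases hβy.eq_or_lt with rfl | hlt
    · exact .refl _
    by_cases hmem : β ∈ f y
    · exact .of_mem hmem
    have hn : ∃ β₀ < β, ∀ γ ∈ f y, β₀ < γ → β < γ := by
      by_contra! hcon
      refine hmem (hcl y β hlt ⟨hβ.1, fun b hb => ?_⟩)
      obtain ⟨γ, hγ, h1, h2⟩ := hcon b hb
      exact ⟨γ, hγ, h1, h2.lt_of_ne fun he => hmem (he ▸ hγ)⟩
    obtain ⟨β₀, hβ₀, hgap⟩ := hn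
    have hstep : ∀ ξ, β₀ < ξ → ξ < β → Reach f y ξ →
        ∃ v, IsLeast (f y ∩ Ici β) v ∧ Reach f v ξ := by
      intro ξ h1 h2 hξ
      cases hξ with
      | refl => exact absurd (h2.trans hlt) (lt_irrefl _)
      | @step _ v _ h hv =>
        refine ⟨v, ⟨⟨h.1.1, (hgap v h.1.1 (h1.trans_le h.1.2)).le⟩, fun w hw => ?_⟩, hv⟩
        exact h.2 ⟨hw.1, h2.le.trans hw.2⟩
    obtain ⟨ξ₀, hξ₀, h1, h2⟩ := hβ.2 β₀ hβ₀
    obtain ⟨v, hv, -⟩ := hstep ξ₀ h1 h2 hξ₀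
    refine .step hv (ih v (hf y hv.1.1) β hv.1.2 ⟨hβ.1, fun b hb => ?_⟩)
    obtain ⟨ξ, hξ, h3, h4⟩ := hβ.2 (max b β₀) (max_lt hb hβ₀)
    obtain ⟨v', hv', hr⟩ := hstep ξ ((le_max_right _ _).trans_lt h3) h4 hξ
    rw [hv'.unique hv] at hr
    exact ⟨ξ, hr, (le_max_left _ _).trans_lt h3, h4⟩

/-- The same gap argument in the other direction: unless some set on the walk to α already
accumulates to α, walks towards points just below α follow the walk to α and may then continue into
`f α`. -/
theorem Reach.mem_limitPts {y α : Ordinal.{u}} (h : Reach f y α) (hα : α ∈ limitPts (f α)) :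
    α ∈ limitPts {ξ | Reach f y ξ} := by
  induction h with
  | refl => exact limitPts_mono (fun _ h => .of_mem h) hα
  | @step y v α h hv ih =>
    by_cases hl : α ∈ limitPts (f y)
    · exact limitPts_mono (fun _ h => .of_mem h) hl
    have hn : ∃ β₀ < α, ∀ γ ∈ f y, β₀ < γ → α ≤ γ := by
      by_contra! hcon
      exact hl ⟨hα.1, hcon⟩
    obtain ⟨β₀, hβ₀, hgap⟩ := hn
    refine ⟨hα.1, fun b hb => ?_⟩
    obtain ⟨ξ, hξ, h3, h4⟩ := (ih hα).2 (max b β₀) (max_lt hb hβ₀)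
    refine ⟨ξ, Reach.step ⟨⟨h.1.1, h4.le.trans h.1.2⟩, fun w hw => h.2 ⟨hw.1, ?_⟩⟩ hξ,
      (le_max_left _ _).trans_lt h3, h4⟩
    exact hgap w hw.1 (((le_max_right _ _).trans_lt h3).trans_le hw.2)

end Reach

/-! ### Dropping a ladder system into a set of ordinals of large cofinality -/

/-- The elements of `E` of cofinality greater than `ν`. -/
def large (E : Set Ordinal.{u}) (ν : Cardinal.{u}) : Set Ordinal.{u} := {α | α ∈ E ∧ ν < α.cof}

theorem large_mono {E E' : Set Ordinal.{u}} (h : E ⊆ E') (ν : Cardinal.{u}) :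
    large E ν ⊆ large E' ν :=
  fun _ hx => ⟨h hx.1, hx.2⟩

/-- `e` assigns to every limit ordinal a closed unbounded subset of size its cofinality. -/
structure IsCofSystem (e : Ordinal.{u} → Set Ordinal.{u}) : Prop where
  subset : ∀ y, IsSuccLimit y → e y ⊆ Iio y
  cofinal : ∀ y, IsSuccLimit y → ∀ β < y, ∃ γ ∈ e y, β ≤ γ
  closed : ∀ y, IsSuccLimit y → ∀ β < y, β ∈ limitPts (e y) → β ∈ e y
  card_le : ∀ y, IsSuccLimit y → #(e y) ≤ Cardinal.lift.{u + 1} y.cof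

theorem exists_isCofSystem : ∃ e : Ordinal.{u} → Set Ordinal.{u}, IsCofSystem e := by
  choose! e he using exists_closed_cofinal_card_le
  exact ⟨e, fun y hy => (he y hy).1, fun y hy => (he y hy).2.1, fun y hy => (he y hy).2.2.1,
    fun y hy => (he y hy).2.2.2⟩

/-- If `y` is a limit ordinal of cofinality at most `ν`, the set of the largest elements of the
closure of `D` below elements of `e y`. -/
def dropSet (e : Ordinal.{u} → Set Ordinal.{u}) (D : Set Ordinal.{u}) (ν : Cardinal.{u})
    (y : Ordinal.{u}) : Set Ordinal.{u} :=
  {β | IsSuccLimit y ∧ y.cof ≤ ν ∧ ∃ γ ∈ e y, IsGreatest (clos D ∩ Iic γ) β}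

section dropSet

variable {e : Ordinal.{u} → Set Ordinal.{u}} (he : IsCofSystem e)
  (D : Set Ordinal.{u}) (ν : Cardinal.{u})

include he

theorem dropSet_subset (y : Ordinal.{u}) : dropSet e D ν y ⊆ Iio y := by
  rintro β ⟨hy, -, γ, hγ, hβ⟩
  exact (mem_Iic.1 hβ.1.2).trans_lt (mem_Iio.1 (he.subset y hy hγ))

theorem mk_dropSet_le (y : Ordinal.{u}) : #(dropSet e D ν y) ≤ Cardinal.lift.{u + 1} ν := by
  by_cases h : IsSuccLimit y ∧ y.cof ≤ ν
  · have hsub : dropSet e D ν y ⊆ (fun γ => sSup (clos D ∩ Iic γ)) '' e y := by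
      rintro β ⟨-, -, γ, hγ, hβ⟩
      exact ⟨γ, hγ, hβ.csSup_eq⟩
    exact (Cardinal.mk_le_mk_of_subset hsub).trans <| Cardinal.mk_image_le.trans <|
      (he.card_le y h.1).trans (Cardinal.lift_le.2 h.2)
  · have : dropSet e D ν y = ∅ := eq_empty_of_forall_notMem fun β hβ => h ⟨hβ.1, hβ.2.1⟩
    simp [this]

/-- If drops accumulate to β, then β is in the closure of `D`, so any γ ≥ β drops to at least β. The
γ whose drops lie below β are thus themselves below β and accumulate to it, so β is in `e y` and
drops to itself. -/
theorem mem_dropSet_of_mem_limitPts (y : Ordinal.{u}) :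
    ∀ β < y, β ∈ limitPts (dropSet e D ν y) → β ∈ dropSet e D ν y := by
  intro β hβ hl
  obtain ⟨-, ⟨hy, hc, -⟩, -⟩ := hl.2 0 (pos_iff_ne_zero.2 hl.1)
  have hβD : β ∈ clos D := by
    refine Or.inr ?_
    rw [← limitPts_clos]
    refine limitPts_mono ?_ hl
    rintro w ⟨-, -, γ, -, hw⟩
    exact hw.1.1
  refine ⟨hy, hc, β, he.closed y hy β hβ ⟨hl.1, fun b hb => ?_⟩, ⟨hβD, mem_Iic.2 le_rfl⟩,
    fun w hw => hw.2⟩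
  obtain ⟨w, ⟨-, -, γ, hγ, hw⟩, h1, h2⟩ := hl.2 b hb
  refine ⟨γ, hγ, h1.trans_le hw.1.2, ?_⟩
  by_contra! hn
  exact (hw.2 ⟨hβD, hn⟩).not_gt h2

theorem mem_limitPts_dropSet {α : Ordinal.{u}} (hα : α ∈ limitPts D) (hc : α.cof ≤ ν) :
    α ∈ limitPts (dropSet e D ν α) := by
  have hlim := isSuccLimit_of_mem_limitPts hα
  refine ⟨hα.1, fun β hβ => ?_⟩
  obtain ⟨d, hd, h1, h2⟩ := hα.2 β hβ
  obtain ⟨γ, hγ, h3⟩ := he.cofinal α hlim d h2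
  have hd' : d ∈ clos D ∩ Iic γ := ⟨Or.inl hd, h3⟩
  have hg := isGreatest_csSup_clos ⟨d, hd'⟩
  exact ⟨_, ⟨hlim, hc, γ, hγ, hg⟩, h1.trans_le (hg.2 hd'),
    hg.1.2.trans_lt (he.subset α hlim hγ)⟩

theorem mk_reach_dropSet_le (hν : 1 ≤ ν) (y : Ordinal.{u}) :
    #{β | Reach (dropSet e D ν) y β} ≤ Cardinal.lift.{u + 1} ν := by
  rcases le_or_gt ℵ₀ ν with h | h
  · exact mk_reach_le (dropSet_subset he D ν) (by simpa using h) (mk_dropSet_le he D ν) y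
  -- For finite `ν` no limit ordinal has cofinality at most `ν`, so every walk stops at its start.
  · have hsub : {β | Reach (dropSet e D ν) y β} ⊆ {y} := by
      intro β hβ
      cases hβ with
      | refl => rfl
      | step h' hv =>
        have h1 := one_lt_cof_iff.2 h'.1.1.1
        exact absurd (h'.1.1.2.1.trans_lt h) (not_lt.2 (Ordinal.aleph0_le_cof_iff.2 h1))
    refine (Cardinal.mk_le_mk_of_subset hsub).trans ?_
    simpa using hν

/-- Points reached after at least one step are drops. With cofinality at most `ν` they are outside
`large D ν`, so they are limits of it. -/
theorem mem_limitPts_reach_dropSet {y α : Ordinal.{u}}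
    (h : Reach (dropSet e (large D ν) ν) y α) (hc : α.cof ≤ ν)
    (hα : α ≠ y ∨ α ∈ limitPts (large D ν)) :
    α ∈ limitPts {ξ | Reach (dropSet e (large D ν) ν) y ξ} := by
  refine h.mem_limitPts (mem_limitPts_dropSet he _ _ ?_ hc)
  rcases h.eq_or_mem with rfl | ⟨v, -, -, γ, -, hg⟩
  · exact hα.resolve_left (by simp)
  · exact hg.1.1.resolve_left fun h => h.2.not_ge hc

/-- Walks towards a fixed point along decreasing sets are eventually constant. -/
theorem exists_eventually_reach (E : Ordinal.{u} → Set Ordinal.{u}) (hE : Antitone E)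
    {θ : Ordinal.{u}} (hθ : IsSuccLimit θ) (hν : 1 ≤ ν) {β : Ordinal.{u}}
    (hβ : ∀ ζ < θ, β ∈ large (E ζ) ν) (hβc : ν < β.cof) (y : Ordinal.{u}) :
    IsSuccLimit y → β ≤ y → ∃ ζ₀ < θ, ∃ t, β ≤ t ∧ t ≤ y ∧ ν < t.cof ∧
      ∀ ζ, ζ₀ ≤ ζ → ζ < θ → Reach (dropSet e (large (E ζ) ν) ν) y t ∧
        (t = y ∨ t ∈ clos (large (E ζ) ν)) := by
  have hθ0 : 0 < θ := pos_iff_ne_zero.2 (by simpa using hθ.1)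
  induction y using WellFoundedLT.induction with
  | ind y ih =>
    intro hy hβy
    rcases lt_or_ge ν y.cof with hc | hc
    · exact ⟨0, hθ0, y, hβy, le_rfl, hc, fun ζ _ _ => ⟨.refl y, Or.inl rfl⟩⟩
    have hlt : β < y := hβy.lt_of_ne fun he => (he ▸ hβc).not_ge hc
    have hne : (e y ∩ Ici β).Nonempty := by
      obtain ⟨γ, hγ, h1⟩ := he.cofinal y hy β hlt
      exact ⟨γ, hγ, h1⟩
    obtain ⟨γ, hγ⟩ : ∃ γ, IsLeast (e y ∩ Ici β) γ := ⟨_, isLeast_csInf hne⟩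
    set w : Ordinal.{u} → Ordinal.{u} := fun ζ => sSup (clos (large (E ζ) ν) ∩ Iic γ)
    have hmem : ∀ ζ < θ, β ∈ clos (large (E ζ) ν) ∩ Iic γ := fun ζ hζ =>
      ⟨Or.inl (hβ ζ hζ), hγ.1.2⟩
    have hg : ∀ ζ < θ, IsGreatest (clos (large (E ζ) ν) ∩ Iic γ) (w ζ) := fun ζ hζ =>
      isGreatest_csSup_clos ⟨β, hmem ζ hζ⟩
    have hanti : ∀ ζ ζ', ζ ≤ ζ' → ζ' < θ → w ζ' ≤ w ζ := fun ζ ζ' h h' =>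
      (hg ζ (h.trans_lt h')).2
        ⟨clos_mono (large_mono (hE h) ν) (hg ζ' h').1.1, (hg ζ' h').1.2⟩
    -- The drop of γ decreases with ζ and so is constant once it attains its minimum. The induction
    -- hypothesis is applied to that value, which is below y and still at least β.
    obtain ⟨w₀, ⟨⟨ζ₁, hζ₁, hw₀⟩, hmin⟩⟩ : ∃ w₀, IsLeast (w '' Iio θ) w₀ :=
      ⟨_, isLeast_csInf ⟨w 0, 0, hθ0, rfl⟩⟩
    have hconst : ∀ ζ, ζ₁ ≤ ζ → ζ < θ → w ζ = w₀ := fun ζ h h' =>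
      le_antisymm ((hanti ζ₁ ζ h h').trans hw₀.le) (hmin ⟨ζ, h', rfl⟩)
    have hg₁ := hg ζ₁ hζ₁
    rw [hw₀] at hg₁
    have hwlim : IsSuccLimit w₀ := by
      rcases hg₁.1.1 with h | h
      · exact one_lt_cof_iff.1 (hν.trans_lt h.2)
      · exact isSuccLimit_of_mem_limitPts h
    have hwy : w₀ < y := hg₁.1.2.trans_lt (he.subset y hy hγ.1.1)
    obtain ⟨ζ₂, hζ₂, t, ht1, ht2, ht3, ht⟩ := ih w₀ hwy hwlim (hg₁.2 (hmem ζ₁ hζ₁))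
    refine ⟨max ζ₁ ζ₂, max_lt hζ₁ hζ₂, t, ht1, ht2.trans hwy.le, ht3, fun ζ h h' => ?_⟩
    have hgζ := hg ζ h'
    rw [hconst ζ ((le_max_left _ _).trans h) h'] at hgζ
    obtain ⟨hr, ht'⟩ := ht ζ ((le_max_right _ _).trans h) h'
    refine ⟨.step ⟨⟨⟨hy, hc, γ, hγ.1.1, hgζ⟩, ht2⟩, ?_⟩ hr, Or.inr ?_⟩
    -- A walk towards t also steps to the drop of γ: any γ' dropping to a point at least t satisfies
    -- γ' ≥ β, hence γ' ≥ γ, and its drop is no smaller.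
    · rintro v ⟨⟨-, -, γ', hγ', hv⟩, htv⟩
      refine hv.2 ⟨hgζ.1.1, hgζ.1.2.trans (hγ.2 ⟨hγ', ?_⟩)⟩
      exact (ht1.trans htv).trans hv.1.2
    · rcases ht' with rfl | h
      · exact hgζ.1.1
      · exact h

end dropSet

/-! ### Gluing closed sets along a ladder -/

/-- The range of the ladder `c` together with the parts of `B a` in the interval `(c a, c (a+1)]`. -/
def glue (s : Cardinal.{u}) (c : Ordinal.{u} → Ordinal.{u}) (B : Ordinal.{u} → Set Ordinal.{u}) :
    Set Ordinal.{u} :=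
  ran s c ∪ {β | ∃ a < s.ord, β ∈ interval c a ∩ B a}

section glue

variable {s : Cardinal.{u}} {δ : Ordinal.{u}} {c : Ordinal.{u} → Ordinal.{u}}
  {B : Ordinal.{u} → Set Ordinal.{u}} (hs : IsSuccLimit s.ord) (hc : IsLadder s δ c)

include hs hc

theorem IsLadder.apply_lt_apply_add_one {a : Ordinal.{u}} (ha : a < s.ord) : c a < c (a + 1) :=
  hc.strictMonoOn ha (hs.add_one_lt ha) (lt_add_one a)

theorem IsLadder.eq_of_mem_interval {a b x : Ordinal.{u}} (ha : a < s.ord) (hb : b < s.ord)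
    (hxa : x ∈ interval c a) (hxb : x ∈ interval c b) : a = b := by
  have key : ∀ a < s.ord, ∀ b < s.ord, x ∈ interval c a → x ∈ interval c b → ¬ a < b := by
    intro a ha b hb h1 h2 hlt
    have : c (a + 1) ≤ c b :=
      hc.strictMonoOn.monotoneOn (hs.add_one_lt ha) hb (add_one_le_iff.2 hlt)
    exact (h1.2.trans this).not_gt h2.1
  exact le_antisymm (not_lt.1 (key b hb a ha hxb hxa)) (not_lt.1 (key a ha b hb hxa hxb))

theorem glue_inter_interval (hB : ∀ a < s.ord, c (a + 1) ∈ B a) {a : Ordinal.{u}}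
    (ha : a < s.ord) : glue s c B ∩ interval c a = interval c a ∩ B a := by
  ext x
  constructor
  · rintro ⟨⟨b, hb, rfl⟩ | ⟨b, hb, hx⟩, hxa⟩
    · have h1 : a < b := (hc.strictMonoOn.lt_iff_lt ha hb).1 hxa.1
      have h2 : b ≤ a + 1 := (hc.strictMonoOn.le_iff_le hb (hs.add_one_lt ha)).1 hxa.2
      obtain rfl : b = a + 1 := le_antisymm h2 (add_one_le_iff.2 h1)
      exact ⟨hxa, hB a ha⟩
    · obtain rfl := hc.eq_of_mem_interval hs ha hb hxa hx.1
      exact hx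
  · intro hx
    exact ⟨Or.inr ⟨a, ha, hx⟩, hx.1⟩

theorem mem_limitPts_glue_iff (hB : ∀ a < s.ord, c (a + 1) ∈ B a) {a x : Ordinal.{u}}
    (ha : a < s.ord) (hx : x ∈ interval c a) :
    x ∈ limitPts (glue s c B) ↔ x ∈ limitPts (interval c a ∩ B a) := by
  rw [← glue_inter_interval hs hc hB ha]
  refine ⟨fun h => ⟨h.1, fun β hβ => ?_⟩, fun h => limitPts_mono inter_subset_left h⟩
  obtain ⟨γ, hγ, h1, h2⟩ := h.2 (max β (c a)) (max_lt hβ hx.1)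
  exact ⟨γ, ⟨hγ, (le_max_right _ _).trans_lt h1, h2.le.trans hx.2⟩,
    (le_max_left _ _).trans_lt h1, h2⟩

theorem isClubIn_glue (hB : ∀ a < s.ord, c (a + 1) ∈ B a)
    (hBcl : ∀ a < s.ord, ∀ β ≤ c (a + 1), β ∈ limitPts (B a) → β ∈ B a) :
    IsClubIn δ (glue s c B) := by
  have hs0 : 0 < s.ord := pos_iff_ne_zero.2 (by simpa using hs.1)
  refine isClubIn_iff.2 ⟨?_, fun β hβ => ?_, fun β hβ hl => ?_⟩
  · rintro x (⟨b, hb, rfl⟩ | ⟨b, hb, hx⟩)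
    · exact hc.lt b hb
    · exact hx.1.2.trans_lt (hc.lt _ (hs.add_one_lt hb))
  · obtain ⟨ξ, hξ, h⟩ := hc.cofinal β hβ
    exact ⟨_, Or.inl ⟨ξ, hξ, rfl⟩, h⟩
  -- Locate the limit point β by the first ladder point at or above it. Index zero is impossible, a
  -- successor index puts β in an interval, and at a limit index continuity makes β a ladder point.
  · obtain ⟨ξ, ⟨hξ, hle⟩, hmin⟩ : ∃ ξ, IsLeast {ξ | ξ < s.ord ∧ β ≤ c ξ} ξ :=
      ⟨_, isLeast_csInf (hc.cofinal β hβ)⟩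
    have hlt : ∀ η < ξ, c η < β := fun η hη => by
      by_contra! hn
      exact (hmin ⟨hη.trans hξ, hn⟩).not_gt hη
    rcases zero_or_succ_or_isSuccLimit ξ with rfl | ⟨a, rfl⟩ | hlim
    · obtain ⟨γ, hγ, -, h2⟩ := hl.2 0 (pos_iff_ne_zero.2 hl.1)
      have h0 : c 0 ≤ γ := by
        rcases hγ with ⟨b, hb, rfl⟩ | ⟨b, hb, hx⟩
        · exact hc.strictMonoOn.monotoneOn hs0 hb zero_le
        · exact (hc.strictMonoOn.monotoneOn hs0 hb zero_le).trans hx.1.1.le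
      exact absurd (h0.trans_lt h2) (not_lt.2 hle)
    · have ha : a < s.ord := (lt_succ a).trans hξ
      have hx : β ∈ interval c a := ⟨hlt a (lt_succ a), hle⟩
      have h1 := (mem_limitPts_glue_iff hs hc hB ha hx).1 hl
      exact Or.inr ⟨a, ha, hx, hBcl a ha β hle (limitPts_mono inter_subset_right h1)⟩
    · refine Or.inl ⟨ξ, hξ, ?_⟩
      refine le_antisymm ((hc.continuous ξ hξ hlim).2 ?_) hle
      rintro _ ⟨η, hη, rfl⟩
      exact (hlt η hη).le

end glue

/-! ### Clubs of a regular cardinal -/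

/-- Transfinite iteration of `F` on clubs, with intersections taken at every stage. -/
noncomputable def iterClub (l : Cardinal.{u}) (F : Set Ordinal.{u} → Set Ordinal.{u})
    (ζ : Ordinal.{u}) : Set Ordinal.{u} :=
  {x | x < l.ord ∧ ∀ η, (_ : η < ζ) → x ∈ F (iterClub l F η)}
termination_by ζ

theorem mem_iterClub {l : Cardinal.{u}} {F : Set Ordinal.{u} → Set Ordinal.{u}} {ζ x : Ordinal.{u}} :
    x ∈ iterClub l F ζ ↔ x < l.ord ∧ ∀ η < ζ, x ∈ F (iterClub l F η) := by
  rw [iterClub]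
  rfl

theorem iterClub_antitone {l : Cardinal.{u}} (F : Set Ordinal.{u} → Set Ordinal.{u}) : Antitone (iterClub l F) := by
  intro ζ ζ' h x hx
  rw [mem_iterClub] at hx ⊢
  exact ⟨hx.1, fun η hη => hx.2 η (hη.trans_le h)⟩

section regular

variable {l : Cardinal.{u}} (hl : l.IsRegular)

include hl

theorem exists_lt_ord_forall_lt {o : Ordinal.{u}} (ho : o < l.ord) (g : Ordinal.{u} → Ordinal.{u})
    (hg : ∀ ξ < o, g ξ < l.ord) : ∃ b < l.ord, ∀ ξ < o, g ξ < b := by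
  refine ⟨sSup ((· + 1) '' (g '' Iio o)), sSup_add_one_lt_of_lt_cof ?_ ?_, fun ξ hξ => ?_⟩
  · refine Cardinal.mk_image_le.trans_lt ?_
    rw [← lift_cof, hl.cof_ord, Cardinal.mk_Iio_ordinal, Cardinal.lift_lt]
    exact lt_ord.1 ho
  · rintro _ ⟨ξ, hξ, rfl⟩
    exact hg ξ hξ
  · refine (lt_add_one (g ξ)).trans_le (le_csSup bddAbove_of_small ?_)
    exact ⟨_, ⟨ξ, hξ, rfl⟩, rfl⟩

/-- Take the supremum of the first ρ elements of `A` above β; regularity of l keeps it below l. -/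
theorem exists_mem_limitPts_cof_eq {A : Set Ordinal.{u}}
    (hA : ∀ β < l.ord, ∃ γ ∈ A, β ≤ γ ∧ γ < l.ord) {ρ : Cardinal.{u}} (hρ : ρ.IsRegular)
    (hρl : ρ < l) {β : Ordinal.{u}} (hβ : β < l.ord) :
    ∃ α < l.ord, β < α ∧ α.cof = ρ ∧ α ∈ limitPts A := by
  have hlim : IsSuccLimit l.ord := isSuccLimit_ord hl.aleph0_le
  have hρlim : IsSuccLimit ρ.ord := isSuccLimit_ord hρ.aleph0_le
  have hρo : ρ.ord < l.ord := ord_lt_ord.2 hρl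
  -- The tail above `l.ord` only makes `T` a proper class, as `enumOrd` needs; the values at indices
  -- below `l.ord` come from `A`.
  set T : Set Ordinal.{u} := {x | x ∈ A ∧ β < x} ∪ Ici l.ord
  have hTb : ¬ BddAbove T := fun ⟨b, hb⟩ => by
    have : max b l.ord + 1 ∈ T := Or.inr ((le_max_right b _).trans (lt_add_one _).le)
    exact ((le_max_left b l.ord).trans_lt (lt_add_one _)).not_ge (hb this)
  have hlt : ∀ ξ < l.ord, enumOrd T ξ < l.ord := by
    intro ξ
    induction ξ using WellFoundedLT.induction with
    | ind ξ ih =>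
      intro hξ
      obtain ⟨b, hb, hb'⟩ := exists_lt_ord_forall_lt hl hξ (enumOrd T)
        fun η hη => ih η hη (hη.trans hξ)
      obtain ⟨γ, hγ, h1, h2⟩ := hA (max b (β + 1)) (max_lt hb (hlim.add_one_lt hβ))
      refine lt_of_le_of_lt (enumOrd_le_of_forall_lt (Or.inl ⟨hγ, ?_⟩) fun η hη => ?_) h2
      · exact (lt_add_one β).trans_le ((le_max_right _ _).trans h1)
      · exact (hb' η hη).trans_le ((le_max_left _ _).trans h1)
  have hmem : ∀ ξ < l.ord, enumOrd T ξ ∈ A ∧ β < enumOrd T ξ := fun ξ hξ =>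
    (enumOrd_mem hTb ξ).resolve_right (not_le.2 (hlt ξ hξ))
  have hmono := enumOrd_strictMono hTb
  let f : Iio ρ.ord → Ordinal.{u} := fun ξ => enumOrd T ξ
  have hf : StrictMono f := fun a b h => hmono h
  have hb : BddAbove (range f) := bddAbove_of_small
  have hflt : ∀ ξ, f ξ < ⨆ ξ, f ξ := fun ξ =>
    (hf (show ξ < ⟨ξ.1 + 1, hρlim.add_one_lt ξ.2⟩ from lt_add_one ξ.1)).trans_le
      (le_ciSup hb _)
  obtain ⟨b, hbl, hb'⟩ := exists_lt_ord_forall_lt hl hρo (enumOrd T)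
    fun η hη => hlt η (hη.trans hρo)
  have hβf : β < ⨆ ξ, f ξ := (hmem 0 hl.ord_pos).2.trans (hflt ⟨0, hρ.ord_pos⟩)
  refine ⟨⨆ ξ, f ξ, lt_of_le_of_lt (ciSup_le' fun ξ => (hb' ξ.1 ξ.2).le) hbl, hβf, ?_,
    (zero_le.trans_lt hβf).ne', fun η hη => ?_⟩
  · rw [cof_iSup_Iio hf hρlim.isSuccPrelimit, hρ.cof_ord]
  · have : Nonempty (Iio ρ.ord) := ⟨⟨0, hρ.ord_pos⟩⟩
    obtain ⟨ξ, hξ⟩ := exists_lt_of_lt_ciSup hη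
    exact ⟨f ξ, (hmem ξ.1 (ξ.2.trans hρo)).1, hξ, hflt ξ⟩

theorem isClubIn_limitPts_large {E : Set Ordinal.{u}} (hE : IsClubIn l.ord E) (hl0 : ℵ₀ < l)
    {ν : Cardinal.{u}} (hν : succ ν < l) :
    IsClubIn l.ord {α | α < l.ord ∧ α ∈ limitPts (large E ν)} := by
  obtain ⟨hEl, hEu, hEc⟩ := isClubIn_iff.1 hE
  -- `succ ν` is regular only for infinite `ν`; for finite `ν` use `ℵ₀`.
  obtain ⟨ρ, hρ, hνρ, hρl⟩ : ∃ ρ : Cardinal.{u}, ρ.IsRegular ∧ ν < ρ ∧ ρ < l := by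
    rcases le_or_gt ℵ₀ ν with h | h
    · exact ⟨succ ν, isRegular_succ h, lt_succ ν, hν⟩
    · exact ⟨ℵ₀, isRegular_aleph0, h, hl0⟩
  have hlarge : ∀ β < l.ord, ∃ γ ∈ large E ν, β ≤ γ ∧ γ < l.ord := fun β hβ => by
    obtain ⟨α, h1, h2, h3, h4⟩ := exists_mem_limitPts_cof_eq hl (A := E)
      (fun β hβ => by
        obtain ⟨γ, hγ, h⟩ := hEu β hβ
        exact ⟨γ, hγ, h, hEl hγ⟩) hρ hρl hβ
    exact ⟨α, ⟨hEc α h1 h4, h3 ▸ hνρ⟩, h2.le, h1⟩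
  refine isClubIn_iff.2 ⟨fun x hx => hx.1, fun β hβ => ?_, fun β hβ h => ⟨hβ, ?_⟩⟩
  · obtain ⟨α, h1, h2, -, h4⟩ := exists_mem_limitPts_cof_eq hl hlarge isRegular_aleph0 hl0 hβ
    exact ⟨α, ⟨h1, h4⟩, h2.le⟩
  · rw [← limitPts_clos]
    exact limitPts_mono (fun x hx => Or.inr hx.2) h

theorem isClubIn_biInter (hl0 : ℵ₀ < l) {o : Ordinal.{u}} (ho : o < l.ord)
    {E : Ordinal.{u} → Set Ordinal.{u}} (hE : ∀ ζ < o, IsClubIn l.ord (E ζ)) :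
    IsClubIn l.ord {x | x < l.ord ∧ ∀ ζ < o, x ∈ E ζ} := by
  have hcof : Order.cof (Iio l.ord) = Cardinal.lift.{u + 1} l := by
    rw [cof_Iio, ← lift_cof, hl.cof_ord]
  have h := IsClub.iInter (α := Iio l.ord)
    (f := fun ζ : Iio o => (fun x : Iio l.ord => (x : Ordinal.{u})) ⁻¹' E ζ)
    (by rw [hcof, ← Cardinal.lift_aleph0.{u + 1, u}]; exact (Cardinal.lift_lt.2 hl0).ne')
    (by
      rw [hcof, Cardinal.mk_Iio_ordinal]
      exact Cardinal.lift_lt.2 (Cardinal.lift_lt.2 (lt_ord.1 ho)))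
    (fun ζ => (hE ζ ζ.2).2)
  refine ⟨fun x hx => hx.1, ?_⟩
  convert h using 1
  ext x
  have hx : x.1 < l.ord := x.2
  simp [hx]

theorem isClubIn_iterClub (hl0 : ℵ₀ < l) {F : Set Ordinal.{u} → Set Ordinal.{u}}
    (hF : ∀ E, IsClubIn l.ord E → IsClubIn l.ord (F E)) (ζ : Ordinal.{u}) (hζ : ζ < l.ord) :
    IsClubIn l.ord (iterClub l F ζ) := by
  induction ζ using WellFoundedLT.induction with
  | ind ζ ih =>
    have h := isClubIn_biInter hl hl0 hζ (E := fun η => F (iterClub l F η))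
      fun η hη => hF _ (ih η hη (hη.trans hζ))
    convert h using 1
    ext x
    exact mem_iterClub

end regular

theorem mem_acc_iff {δ α : Ordinal.{u}} {C : Set Ordinal.{u}} :
    α ∈ acc δ C ↔ α < δ ∧ α ∈ limitPts C := by
  rw [mem_limitPts_iff_isLUB]
  rfl

theorem isLimitOfCofGT_iff {ν : Cardinal.{u}} {α : Ordinal.{u}} :
    IsLimitOfCofGT ν α ↔ α ∈ limitPts (large univ ν) := by
  rw [mem_limitPts_iff_isLUB, IsLimitOfCofGT]
  have : {β | β < α ∧ ν < β.cof} = large univ ν ∩ Iio α := by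
    ext β
    simp [large, and_comm]
  rw [this]

/-! ### The off-center club system -/

open Classical in
/-- The set into which the walks from `y` are dropped: `E` if `y` is a limit of elements of `E` of
cofinality greater than `ν`, and everything otherwise. -/
noncomputable def guide (E : Set Ordinal.{u}) (ν : Cardinal.{u}) (y : Ordinal.{u}) :
    Set Ordinal.{u} :=
  if y ∈ limitPts (large E ν) then E else univ

/-- The points reached from `y` by walks along `e` dropped into `guide E ν y`. -/
def block (e : Ordinal.{u} → Set Ordinal.{u}) (E : Set Ordinal.{u}) (ν : Cardinal.{u})
    (y : Ordinal.{u}) : Set Ordinal.{u} :=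
  {β | Reach (dropSet e (large (guide E ν y) ν) ν) y β}

/-- The ladder `c` with `block e E (ν a) (c (a + 1))` inserted into the `a`-th interval. -/
def offCenterClub (s : Cardinal.{u}) (e : Ordinal.{u} → Set Ordinal.{u})
    (ν : Ordinal.{u} → Cardinal.{u}) (E : Set Ordinal.{u}) (c : Ordinal.{u} → Ordinal.{u}) :
    Set Ordinal.{u} :=
  glue s c fun a => block e E (ν a) (c (a + 1))

section offCenterClub

variable {s : Cardinal.{u}} {e : Ordinal.{u} → Set Ordinal.{u}}
  {ν : Ordinal.{u} → Cardinal.{u}} {E : Set Ordinal.{u}} {c : Ordinal.{u} → Ordinal.{u}}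
  {δ : Ordinal.{u}} (hs : IsSuccLimit s.ord) (he : IsCofSystem e) (hc : IsLadder s δ c)

theorem self_mem_block (E : Set Ordinal.{u}) (ν : Cardinal.{u}) (y : Ordinal.{u}) :
    y ∈ block e E ν y :=
  Reach.refl y

include hs he hc

theorem isClubIn_offCenterClub : IsClubIn δ (offCenterClub s e ν E c) :=
  isClubIn_glue hs hc (fun _ _ => self_mem_block _ _ _) fun _ _ β hβ h =>
    Reach.of_mem_limitPts (dropSet_subset he _ _) (mem_dropSet_of_mem_limitPts he _ _) _ β hβ h

theorem mk_offCenterClub_inter_interval_le (hν : ∀ a, 1 ≤ ν a) {a : Ordinal.{u}}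
    (ha : a < s.ord) :
    #(offCenterClub s e ν E c ∩ interval c a : Set Ordinal.{u}) ≤
      Cardinal.lift.{u + 1} (ν a) := by
  rw [offCenterClub, glue_inter_interval hs hc (fun _ _ => self_mem_block _ _ _) ha]
  exact (Cardinal.mk_le_mk_of_subset inter_subset_right).trans
    (mk_reach_dropSet_le he _ _ (hν a) _)

theorem mem_acc_offCenterClub {a α : Ordinal.{u}} (ha : a < s.ord)
    (hα : α ∈ offCenterClub s e ν E c) (hαa : α ∈ interval c a) (hcof : α.cof ≤ ν a)
    (h : α ≠ c (a + 1) ∨ α ∈ limitPts (large (guide E (ν a) (c (a + 1))) (ν a))) :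
    α ∈ acc δ (offCenterClub s e ν E c) := by
  have hB : ∀ a < s.ord, c (a + 1) ∈ block e E (ν a) (c (a + 1)) :=
    fun _ _ => self_mem_block _ _ _
  refine mem_acc_iff.2 ⟨hαa.2.trans_lt (hc.lt _ (hs.add_one_lt ha)), ?_⟩
  have hα' : α ∈ offCenterClub s e ν E c ∩ interval c a := ⟨hα, hαa⟩
  rw [offCenterClub, glue_inter_interval hs hc hB ha] at hα'
  have hl := mem_limitPts_reach_dropSet he _ _ hα'.2 hcof h
  refine (mem_limitPts_glue_iff hs hc hB ha hαa).2 ⟨hl.1, fun β hβ => ?_⟩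
  obtain ⟨γ, hγ, h1, h2⟩ := hl.2 (max β (c a)) (max_lt hβ hαa.1)
  exact ⟨γ, ⟨⟨(le_max_right _ _).trans_lt h1, h2.le.trans hαa.2⟩, hγ⟩,
    (le_max_left _ _).trans_lt h1, h2⟩

/-- Here the endpoint is itself a limit of the guiding set, so the argument for interior points
covers it too and no exception remains. -/
theorem lt_cof_of_mem_nacc {a α : Ordinal.{u}} (ha : a < s.ord)
    (hα : α ∈ nacc δ (offCenterClub s e ν E c) ∩ interval c a)
    (h : c (a + 1) ∈ limitPts (large E (ν a))) : ν a < α.cof := by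
  by_contra! hn
  refine hα.1.2 (mem_acc_offCenterClub hs he hc ha hα.1.1 hα.2 hn ?_)
  rw [guide, if_pos h]
  exact or_iff_not_imp_left.2 fun h' => not_not.1 h' ▸ h

/-- When the endpoint is not a limit of `large E (ν a)`, the guide is `univ`, so the endpoint can
fail only by not being a limit of any ordinals of cofinality above `ν a`. -/
theorem lt_cof_or_of_mem_nacc {a α : Ordinal.{u}} (ha : a < s.ord)
    (hα : α ∈ nacc δ (offCenterClub s e ν E c) ∩ interval c a) :
    ν a < α.cof ∨ (α = c (a + 1) ∧ ¬ IsLimitOfCofGT (ν a) α) := by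
  by_cases h : c (a + 1) ∈ limitPts (large E (ν a))
  · exact Or.inl (lt_cof_of_mem_nacc hs he hc ha hα h)
  · refine or_iff_not_imp_left.2 fun hn => ?_
    have hcon : ¬ (_ ∨ _) := fun h' => hα.1.2 (mem_acc_offCenterClub hs he hc ha hα.1.1 hα.2 (not_lt.1 hn) h')
    rw [guide, if_neg h, not_or, not_not] at hcon
    rwa [isLimitOfCofGT_iff]

/-- The club has at most `ν a` points in the interval, too few to accumulate at `t`. -/
theorem mem_nacc_of_reach (hν : ∀ a, 1 ≤ ν a) {a t : Ordinal.{u}} (ha : a < s.ord)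
    (h : c (a + 1) ∈ limitPts (large E (ν a))) (ht : t ∈ interval c a) (hcof : ν a < t.cof)
    (hr : Reach (dropSet e (large E (ν a)) (ν a)) (c (a + 1)) t) :
    t ∈ nacc δ (offCenterClub s e ν E c) := by
  have hB : ∀ a < s.ord, c (a + 1) ∈ block e E (ν a) (c (a + 1)) :=
    fun _ _ => self_mem_block _ _ _
  refine ⟨Or.inr ⟨a, ha, ht, ?_⟩, fun hacc => ?_⟩
  · change Reach _ _ _
    rwa [guide, if_pos h]
  · have h1 := (mem_limitPts_glue_iff hs hc hB ha ht).1 (mem_acc_iff.1 hacc).2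
    have h2 := (lift_cof_le_of_mem_limitPts h1).trans
      (Cardinal.mk_le_mk_of_subset inter_subset_left)
    rw [← glue_inter_interval hs hc hB ha] at h2
    have h3 := h2.trans (mk_offCenterClub_inter_interval_le (E := E) hs he hc hν ha)
    exact (Cardinal.lift_le.1 h3).not_gt hcof

/-- Along a decreasing sequence of clubs of length `θ`, some stage yields a club whose
non-accumulation points meet the next club of the sequence in every interval. -/
theorem exists_stage_nacc_inter_nonempty (hν : ∀ a, 1 ≤ ν a) {l θ : Cardinal.{u}}
    (hθ : θ.IsRegular) (hsθ : s < θ) (hδl : δ < l.ord) {E : Ordinal.{u} → Set Ordinal.{u}}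
    (hE : Antitone E) (hEcl : ∀ ζ < θ.ord, IsClubIn l.ord (E ζ))
    (hcE : ∀ a < s.ord, c (a + 1) ∈ E θ.ord ∧ c (a + 1) ∈ limitPts (large (E θ.ord) (ν a))) :
    ∃ ζ < θ.ord, ∀ a < s.ord,
      (E (ζ + 1) ∩ nacc δ (offCenterClub s e ν (E ζ) c) ∩ interval c a).Nonempty := by
  have hθlim : IsSuccLimit θ.ord := isSuccLimit_ord hθ.aleph0_le
  have main : ∀ a < s.ord, ∃ ζ₀ < θ.ord, ∀ ζ, ζ₀ ≤ ζ → ζ < θ.ord →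
      (E (ζ + 1) ∩ nacc δ (offCenterClub s e ν (E ζ) c) ∩ interval c a).Nonempty := by
    intro a ha
    obtain ⟨hcE1, hcE2⟩ := hcE a ha
    obtain ⟨β, hβ, h1, h2⟩ := hcE2.2 (c a) (hc.apply_lt_apply_add_one hs ha)
    obtain ⟨ζ₀, hζ₀, t, ht1, ht2, ht3, ht⟩ := exists_eventually_reach he (ν a) E hE hθlim (hν a)
      (fun ζ hζ => large_mono (hE hζ.le) _ hβ) hβ.2 (c (a + 1))
      (isSuccLimit_of_mem_limitPts hcE2) h2.le
    refine ⟨ζ₀, hζ₀, fun ζ h h' => ?_⟩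
    have hta : t ∈ interval c a := ⟨h1.trans_le ht1, ht2⟩
    refine ⟨t, ⟨?_, ?_⟩, hta⟩
    -- Membership of `t` in the next club comes from stability at stage ζ+1, while its being a
    -- non-accumulation point comes from stage ζ.
    · have hζ1 := hθlim.add_one_lt h'
      rcases (ht (ζ + 1) (h.trans (lt_add_one ζ).le) hζ1).2 with rfl | ht'
      · exact hE hζ1.le hcE1
      · have htl : t < l.ord := (ht2.trans_lt (hc.lt _ (hs.add_one_lt ha))).trans hδl
        rcases ht' with ht' | ht'
        · exact ht'.1
        · exact (isClubIn_iff.1 (hEcl _ hζ1)).2.2 t htl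
            (limitPts_mono (fun _ hx => hx.1) ht')
    · exact mem_nacc_of_reach hs he hc hν ha (limitPts_mono (large_mono (hE h'.le) _) hcE2) hta ht3
        (ht ζ h h').1
  choose! g hg hmain using main
  -- Fewer than θ thresholds, one per interval, are bounded below the regular θ.
  obtain ⟨ζ, hζ, hgζ⟩ := exists_lt_ord_forall_lt hθ (ord_lt_ord.2 hsθ) g hg
  exact ⟨ζ, hζ, fun a ha => hmain a ha ζ (hgζ a ha).le hζ⟩

end offCenterClub
end OffCenter

/-! ### Choosing a club whose system guesses -/

theorem theorem4p2 (μ κ σ : Cardinal.{u})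
    (hμ : ℵ₀ ≤ μ) (hκ : κ = μ.ord.cof) (hκσ : κ < σ) (hσ : σ.ord.cof = σ) (hσμ : σ < μ)
    (S : Set Ordinal.{u}) (hS : S ⊆ OffCenter.cofSet (succ μ) σ)
    (hSstat : OffCenter.IsStationaryIn (succ μ).ord S)
    (m : Ordinal.{u} → Cardinal.{u}) (hm : OffCenter.IsCardinalLadder μ κ m)
    (c : Ordinal.{u} → Ordinal.{u} → Ordinal.{u}) (hc : OffCenter.IsGuessing (succ μ) σ S c) :
    ∃ C : Ordinal.{u} → Set Ordinal.{u},
      OffCenter.IsClubSystem S C ∧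
      (∀ δ ∈ S, OffCenter.ran σ (c δ) ⊆ C δ) ∧
      (∀ δ ∈ S, ∀ ε < σ.ord, ∀ i < κ.ord,
        #(C δ ∩ OffCenter.interval (c δ) (OffCenter.index κ ε i) : Set Ordinal.{u}) ≤
          Cardinal.lift.{u + 1} (succ (m i))) ∧
      (∀ δ ∈ S, ∀ ε < σ.ord, ∀ i < κ.ord,
        ∀ α ∈ OffCenter.nacc δ (C δ) ∩ OffCenter.interval (c δ) (OffCenter.index κ ε i),
          succ (m i) < α.cof ∨
            (α = c δ (OffCenter.index κ ε i + 1) ∧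
              ¬ OffCenter.IsLimitOfCofGT (succ (m i)) α)) ∧
      (∀ E : Set Ordinal.{u}, OffCenter.IsClubIn (succ μ).ord E →
        OffCenter.IsStationaryIn (succ μ).ord
          {δ | δ ∈ S ∧ ∀ ε < σ.ord, ∀ i < κ.ord,
            (∀ α ∈ OffCenter.nacc δ (C δ) ∩ OffCenter.interval (c δ) (OffCenter.index κ ε i),
              succ (m i) < α.cof) ∧
            (E ∩ OffCenter.nacc δ (C δ) ∩
              OffCenter.interval (c δ) (OffCenter.index κ ε i)).Nonempty}) := by
  have hκ0 : ℵ₀ ≤ κ := by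
    rw [hκ, Ordinal.aleph0_le_cof_iff, one_lt_cof_iff]
    exact isSuccLimit_ord hμ
  have hσ0 : ℵ₀ ≤ σ := hκ0.trans hκσ.le
  have hs : IsSuccLimit σ.ord := isSuccLimit_ord hσ0
  have hl : (succ μ).IsRegular := isRegular_succ hμ
  have hl0 : ℵ₀ < succ μ := hμ.trans_lt (lt_succ μ)
  have hθ : (succ σ).IsRegular := isRegular_succ hσ0
  have hθl : (succ σ).ord < (succ μ).ord :=
    ord_lt_ord.2 ((succ_le_of_lt hσμ).trans_lt (lt_succ μ))
  have hκl : κ.ord < (succ μ).ord := ord_lt_ord.2 ((hκσ.trans hσμ).trans (lt_succ μ))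
  have hκne : κ.ord ≠ 0 := by
    simpa using (aleph0_pos.trans_le hκ0).ne'
  obtain ⟨e, he⟩ := OffCenter.exists_isCofSystem.{u}
  -- The remainder modulo κ recovers i from κ·ε + i, so a single function of the interval's index
  -- encodes the bounds μ_i⁺.
  set ν : Ordinal.{u} → Cardinal.{u} := fun a => succ (m (a % κ.ord)) with hνdef
  have hν : ∀ a, 1 ≤ ν a := fun a => Cardinal.one_le_iff_pos.2 (zero_le.trans_lt (lt_succ _))
  have hmlt : ∀ i < κ.ord, succ (m i) < μ := fun i hi =>
    have hi' := (isSuccLimit_ord hκ0).add_one_lt hi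
    (succ_le_of_lt (hm.strictMonoOn hi hi' (lt_add_one i))).trans_lt (hm.lt _ hi')
  have hνl : ∀ i < κ.ord, succ (succ (m i)) < succ μ := fun i hi =>
    (succ_le_of_lt (hmlt i hi)).trans_lt (lt_succ μ)
  have hidx : ∀ ε < σ.ord, ∀ i < κ.ord, OffCenter.index κ ε i < σ.ord := fun ε hε i hi =>
    isPrincipal_add_ord hσ0 (isPrincipal_mul_ord hσ0 (ord_lt_ord.2 hκσ) hε)
      (hi.trans (ord_lt_ord.2 hκσ))
  have hνidx : ∀ ε, ∀ i < κ.ord, ν (OffCenter.index κ ε i) = succ (m i) := fun ε i hi => by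
    simp only [hνdef, OffCenter.index, mul_add_mod_self, mod_eq_of_lt hi]
  by_contra! hcon
  -- `F` intersects the club that is not guessed with a club avoiding the good δ. When the ladder
  -- consists of limits of `large E (ν a)`, the cofinality requirement holds automatically, so at δ
  -- in `F` it is the hitting requirement that fails.
  have key : ∀ E, ∃ F, OffCenter.IsClubIn (succ μ).ord E →
      OffCenter.IsClubIn (succ μ).ord F ∧ ∀ δ ∈ F, δ ∈ S →
        (∀ a < σ.ord, c δ (a + 1) ∈ OffCenter.limitPts (OffCenter.large E (ν a))) →
        ∃ a < σ.ord, ¬ (F ∩ OffCenter.nacc δ (OffCenter.offCenterClub σ e ν E (c δ)) ∩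
          OffCenter.interval (c δ) a).Nonempty := by
    intro E
    obtain ⟨F, hF, hns⟩ := hcon (fun δ => OffCenter.offCenterClub σ e ν E (c δ))
      (fun δ hδ => OffCenter.isClubIn_offCenterClub hs he (hc.ladder δ hδ))
      (fun δ hδ => subset_union_left)
      (fun δ hδ ε hε i hi => hνidx ε i hi ▸
        OffCenter.mk_offCenterClub_inter_interval_le hs he (hc.ladder δ hδ) hν (hidx ε hε i hi))
      (fun δ hδ ε hε i hi α hα => hνidx ε i hi ▸
        OffCenter.lt_cof_or_of_mem_nacc hs he (hc.ladder δ hδ) (hidx ε hε i hi) hα)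
    rw [OffCenter.IsStationaryIn, not_and, not_isStationary_iff] at hns
    obtain ⟨G, hG, hdisj⟩ := hns fun δ hδ => (hS hδ.1).1
    -- The intersection of two clubs, as a family indexed by the ordinals 0 and 1.
    have hFG := OffCenter.isClubIn_biInter hl hl0 (o := 2)
      (E := fun ζ => if ζ = 0 then F else (fun x : Iio (succ μ).ord => (x : Ordinal.{u})) '' G)
      ((natCast_lt_omega0 2).trans_le (omega0_le_ord.2 hl.aleph0_le)) (fun ζ _ => by
        split_ifs
        · exact hF
        · exact OffCenter.IsClubIn.image_val hG)
    refine ⟨_, fun _ => ⟨hFG, fun δ hδ hδS hlim => ?_⟩⟩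
    have hδF : δ ∈ (fun x : Iio (succ μ).ord => (x : Ordinal.{u})) '' G := by
      simpa using hδ.2 1 one_lt_two
    obtain ⟨x, hxG, rfl⟩ := hδF
    by_contra! hgood
    refine hdisj.notMem_of_mem_right hxG ⟨hδS, fun ε hε i hi => ⟨fun α hα => ?_, ?_⟩⟩
    · rw [← hνidx ε i hi]
      exact OffCenter.lt_cof_of_mem_nacc hs he (hc.ladder x hδS) (hidx ε hε i hi) hα
        (hlim _ (hidx ε hε i hi))
    · refine (hgood _ (hidx ε hε i hi)).mono fun t ht => ⟨⟨?_, ht.1.2⟩, ht.2⟩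
      simpa using ht.1.1.2 0 two_pos
  choose F hF using key
  have hcl := OffCenter.isClubIn_iterClub hl hl0 (F := F) fun E hE => (hF E hE).1
  set E := OffCenter.iterClub (succ μ) F
  have hEanti : Antitone E := OffCenter.iterClub_antitone F
  -- Only κ many bounds occur, so the points that are limits of large-cofinality elements of E_{σ⁺}
  -- for every bound still form a club, which the ladders guess.
  have hElim : OffCenter.IsClubIn (succ μ).ord {x | x < (succ μ).ord ∧ ∀ i < κ.ord,
      x ∈ {α | α < (succ μ).ord ∧
        α ∈ OffCenter.limitPts (OffCenter.large (E (succ σ).ord) (succ (m i)))}} :=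
    OffCenter.isClubIn_biInter hl hl0 hκl fun i hi =>
      OffCenter.isClubIn_limitPts_large hl (hcl _ hθl) hl0 (hνl i hi)
  obtain ⟨x, ⟨hxS, hran⟩, hxE⟩ := (hc.guess _ hElim).2 (hcl _ hθl).2
  have hx : x.1 ∈ OffCenter.iterClub (succ μ) F (succ σ).ord := hxE
  have hlim : ∀ a < σ.ord,
      c x (a + 1) ∈ OffCenter.limitPts (OffCenter.large (E (succ σ).ord) (ν a)) := fun a ha =>
    ((hran ⟨a + 1, hs.add_one_lt ha, rfl⟩).2 _ (mod_lt a hκne)).2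
  obtain ⟨ζ, hζ, hne⟩ := OffCenter.exists_stage_nacc_inter_nonempty hs he (hc.ladder x hxS) hν
    hθ (lt_succ σ) x.2 hEanti (fun ζ hζ => hcl ζ (hζ.trans hθl)) fun a ha =>
      ⟨(OffCenter.isClubIn_iff.1 (hcl _ hθl)).2.2 _
        (((hc.ladder x hxS).lt _ (hs.add_one_lt ha)).trans x.2)
        (OffCenter.limitPts_mono (fun _ h => h.1) (hlim a ha)), hlim a ha⟩
  obtain ⟨a, ha, hna⟩ := (hF _ (hcl ζ (hζ.trans hθl))).2 x
    ((OffCenter.mem_iterClub.1 hx).2 ζ hζ) hxS fun a ha =>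
      OffCenter.limitPts_mono (OffCenter.large_mono (hEanti hζ.le) _) (hlim a ha)
  -- E_{ζ+1} is contained in F(E_ζ), so hitting E_{ζ+1} contradicts the choice of F(E_ζ).
  exact hna ((hne a ha).mono fun t ht =>
    ⟨⟨(OffCenter.mem_iterClub.1 ht.1.1).2 ζ (lt_add_one ζ), ht.1.2⟩, ht.2⟩)
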